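/- Let $\mathbb{D}=\{z\in\mathbb{C}:|z|<1\}$, let $\varphi:\mathbb{D}\to\mathbb{D}$ be holomorphic, let $\alpha>0$, and let $$\theta(z)=\exp\Big(\alpha\,\frac{z+1}{z-1}\Big),\qquad z\in\mathbb{D}.$$ Then the following two statements are equivalent: (a) $\varphi(1)=1$ and $\varphi'(1)\le 1$, in the sense of radial limits: $\lim_{r\to1^-}\varphi(r)=1$, and the limit $\varphi'(1):=\lim_{r\to1^-}\varphi'(r)$ exists and is a real number with $\varphi'(1)\le 1$; (b) $(\theta\circ\varphi)/\theta$ is a Schur function, that is, it is holomorphic on $\mathbb{D}$ and bounded there by $1$ in modulus. Moreover, if $\varphi$ is not the identity map of $\mathbb{D}$, then (a) holds if and only if $1$ is the Denjoy–Wolff point of $\varphi$, that is, the iterates $\varphi_n=\varphi\circ\cdots\circ\varphi$ ($n$ times) converge to the constant $1$ uniformly on compact subsets of $\mathbb{D}$. -/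

import Mathlib

open Set Filter Topology

/-- `φ` restricts to a holomorphic self map of the open unit disc
(values of `φ` outside the disc are irrelevant). -/
structure IsHolomorphicSelfMap (φ : ℂ → ℂ) : Prop where
  differentiableOn : DifferentiableOn ℂ φ (Metric.ball 0 1)
  mapsTo : MapsTo φ (Metric.ball 0 1) (Metric.ball 0 1)

/-- `ψ` belongs to the Schur class: it is holomorphic on the open unit disc and bounded there
by one in modulus. -/
structure IsSchur (ψ : ℂ → ℂ) : Prop where
  differentiableOn : DifferentiableOn ℂ ψ (Metric.ball 0 1)
  norm_le_one : ∀ z ∈ Metric.ball (0 : ℂ) 1, ‖ψ z‖ ≤ 1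

/-- The atomic singular inner function `exp (α (z + 1) / (z - 1))`. -/
noncomputable def atomicInner (α : ℝ) (z : ℂ) : ℂ :=
  Complex.exp (α * ((z + 1) / (z - 1)))

/-- `φ(w) = w` in the sense of radial limits: `φ (r w) → w` as `r → 1⁻`. -/
def IsRadialFixedPoint (φ : ℂ → ℂ) (w : ℂ) : Prop :=
  Tendsto (fun r : ℝ => φ (r * w)) (𝓝[<] 1) (𝓝 w)

/-- `φ'(w) = d` in the sense of radial limits: `φ' (r w) → d` as `r → 1⁻`. -/
def HasRadialDeriv (φ : ℂ → ℂ) (w d : ℂ) : Prop :=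
  Tendsto (fun r : ℝ => deriv φ (r * w)) (𝓝[<] 1) (𝓝 d)

/-- `w` is the Denjoy-Wolff point of `φ`: a point of the closed unit disc to which the iterates
of `φ` converge uniformly on compact subsets of the open unit disc. -/
def IsDenjoyWolffPoint (φ : ℂ → ℂ) (w : ℂ) : Prop :=
  w ∈ Metric.closedBall (0 : ℂ) 1 ∧
    ∀ K : Set ℂ, K ⊆ Metric.ball 0 1 → IsCompact K →
      TendstoUniformlyOn (fun n : ℕ => φ^[n]) (fun _ => w) atTop K

/-! Put C(z) = (1+z)/(1-z). Then θ = exp(-αC), so |θ∘φ/θ| ≤ 1 says exactly Re C ≤ Re C∘φ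
(`PreservesHorodiscs`). All the equivalences pass through this inequality, and Schwarz-Pick supplies
the analysis.

From (a), or from iterates converging to 1, the inequality follows by letting the second point in
Schwarz-Pick tend to 1. Conversely, let 1+c be the largest constant with Re C∘φ ≥ (1+c) Re C, and Q
= C∘φ - (1+c)C. Then Re Q ≥ 0, and extremality of c gives Q(r) = o(1/(1-r)) and Q'(r) = o(1/(1-r)²),
whence φ'(1) = 1/(1+c) ≤ 1 (`exists_hasRadialDeriv`).

For the iterates, Re C increases along orbits. An accumulation point other than 1 would lie in the
open disc and give equality there, making φ a translation in the half-plane; only the zero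
translation, φ = id, allows such a point (`tendsto_iterate`). -/

/-! ### Schwarz-Pick in the disc and in the half-plane -/

open ComplexConjugate in
/-- The norm of a Blaschke factor, in polynomial form. -/
theorem norm_sq_one_sub_conj_mul (a v : ℂ) :
    ‖1 - conj a * v‖ ^ 2 = ‖v - a‖ ^ 2 + (1 - ‖a‖ ^ 2) * (1 - ‖v‖ ^ 2) := by
  simp only [Complex.sq_norm, Complex.normSq_apply, Complex.sub_re, Complex.sub_im,
    Complex.mul_re, Complex.mul_im, Complex.conj_re, Complex.conj_im, Complex.one_re,
    Complex.one_im]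
  ring

theorem norm_sq_lt_one {z : ℂ} (hz : z ∈ Metric.ball (0 : ℂ) 1) : ‖z‖ ^ 2 < 1 := by
  have := mem_ball_zero_iff.1 hz
  nlinarith [norm_nonneg z]

open ComplexConjugate in
theorem one_sub_conj_mul_ne_zero {a v : ℂ} (ha : a ∈ Metric.ball (0 : ℂ) 1)
    (hv : v ∈ Metric.ball (0 : ℂ) 1) : 1 - conj a * v ≠ 0 := by
  intro h
  have h1 := norm_sq_one_sub_conj_mul a v
  rw [h] at h1
  have := mul_pos (sub_pos.2 (norm_sq_lt_one ha)) (sub_pos.2 (norm_sq_lt_one hv))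
  have := sq_nonneg ‖v - a‖
  simp at h1
  linarith

open ComplexConjugate in
/-- The Blaschke factor `(v - a) / (1 - conj a * v)` maps the disc into itself. -/
theorem norm_blaschke_lt_one {a v : ℂ} (ha : a ∈ Metric.ball (0 : ℂ) 1)
    (hv : v ∈ Metric.ball (0 : ℂ) 1) : ‖(v - a) / (1 - conj a * v)‖ < 1 := by
  have h1 := norm_sq_one_sub_conj_mul a v
  have := mul_pos (sub_pos.2 (norm_sq_lt_one ha)) (sub_pos.2 (norm_sq_lt_one hv))
  have h0 : 0 < ‖1 - conj a * v‖ := norm_pos_iff.2 (one_sub_conj_mul_ne_zero ha hv)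
  rw [norm_div, div_lt_one h0]
  exact lt_of_pow_lt_pow_left₀ 2 h0.le (by linarith)

open ComplexConjugate in
/-- The two-point **Schwarz-Pick lemma**. -/
theorem IsHolomorphicSelfMap.schwarz_pick {φ : ℂ → ℂ} (hφ : IsHolomorphicSelfMap φ) {z w : ℂ}
    (hz : z ∈ Metric.ball (0 : ℂ) 1) (hw : w ∈ Metric.ball (0 : ℂ) 1) :
    ‖1 - conj (φ w) * φ z‖ ^ 2 * ((1 - ‖z‖ ^ 2) * (1 - ‖w‖ ^ 2)) ≤
      ‖1 - conj w * z‖ ^ 2 * ((1 - ‖φ z‖ ^ 2) * (1 - ‖φ w‖ ^ 2)) := by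
  have hnw : -w ∈ Metric.ball (0 : ℂ) 1 := by simpa using hw
  -- `τ` sends 0 to `w` and `μ` sends `φ w` to 0, so `μ ∘ φ ∘ τ` fixes 0 and the Schwarz lemma
  -- applies at the point `ζ` with `τ ζ = z`.
  let τ : ℂ → ℂ := fun ζ => (ζ - -w) / (1 - conj (-w) * ζ)
  have hτ : MapsTo τ (Metric.ball 0 1) (Metric.ball 0 1) := fun ζ hζ =>
    mem_ball_zero_iff.2 (norm_blaschke_lt_one hnw hζ)
  have hτd : DifferentiableOn ℂ τ (Metric.ball 0 1) := fun ζ hζ =>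
    DifferentiableAt.differentiableWithinAt
      (by
        have := one_sub_conj_mul_ne_zero hnw hζ
        fun_prop (disch := assumption))
  have hφw := hφ.mapsTo hw
  let μ : ℂ → ℂ := fun v => (v - φ w) / (1 - conj (φ w) * v)
  have hμd : DifferentiableOn ℂ μ (Metric.ball 0 1) := fun v hv =>
    DifferentiableAt.differentiableWithinAt
      (by
        have := one_sub_conj_mul_ne_zero hφw hv
        fun_prop (disch := assumption))
  let ζ : ℂ := (z - w) / (1 - conj w * z)
  have hζ : ‖ζ‖ < 1 := norm_blaschke_lt_one hw hz
  have hd : 1 - conj w * z ≠ 0 := one_sub_conj_mul_ne_zero hw hz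
  have hτζ : τ ζ = z := by
    have h1 : 1 - conj (-w) * ζ ≠ 0 := one_sub_conj_mul_ne_zero hnw (mem_ball_zero_iff.2 hζ)
    simp only [τ]
    rw [div_eq_iff h1]
    have he : ζ * (1 - conj w * z) = z - w := div_mul_cancel₀ _ hd
    rw [map_neg]
    linear_combination he
  have key : ‖μ (φ (τ ζ))‖ ≤ ‖ζ‖ := by
    refine Complex.norm_le_norm_of_mapsTo_ball (f := fun ζ => μ (φ (τ ζ))) (R := 1)
      (hμd.comp (hφ.differentiableOn.comp hτd hτ) (hφ.mapsTo.comp hτ)) (fun v hv => ?_) ?_ hζ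
    · exact mem_closedBall_zero_iff.2
        (norm_blaschke_lt_one hφw (hφ.mapsTo (hτ hv))).le
    · simp [μ, τ]
  rw [hτζ] at key
  have hA := norm_pos_iff.2 hd
  have hB := norm_pos_iff.2 (one_sub_conj_mul_ne_zero hφw (hφ.mapsTo hz))
  simp only [μ, ζ, norm_div] at key
  rw [div_le_div_iff₀ hB hA] at key
  have key2 := pow_le_pow_left₀ (by positivity) key 2
  rw [mul_pow, mul_pow] at key2
  have e1 := norm_sq_one_sub_conj_mul w z
  have e2 := norm_sq_one_sub_conj_mul (φ w) (φ z)
  have e1' : ‖z - w‖ ^ 2 = ‖1 - conj w * z‖ ^ 2 - (1 - ‖w‖ ^ 2) * (1 - ‖z‖ ^ 2) := by linarith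
  have e2' : ‖φ z - φ w‖ ^ 2 =
    ‖1 - conj (φ w) * φ z‖ ^ 2 - (1 - ‖φ w‖ ^ 2) * (1 - ‖φ z‖ ^ 2) := by linarith
  rw [e1', e2'] at key2
  linarith

-- The map v ↦ (v-1)/(v+1) carries the open right half-plane into the disc, which reduces this to
-- `schwarz_pick`.
open ComplexConjugate in
theorem schwarz_pick_of_re_pos {Q : ℂ → ℂ} (hQ : DifferentiableOn ℂ Q (Metric.ball 0 1))
    (hpos : ∀ z ∈ Metric.ball (0 : ℂ) 1, 0 < (Q z).re) {z w : ℂ}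
    (hz : z ∈ Metric.ball (0 : ℂ) 1) (hw : w ∈ Metric.ball (0 : ℂ) 1) :
    ‖Q z + conj (Q w)‖ ^ 2 * ((1 - ‖z‖ ^ 2) * (1 - ‖w‖ ^ 2)) ≤
      ‖1 - conj w * z‖ ^ 2 * (4 * (Q z).re * (Q w).re) := by
  have hne : ∀ z ∈ Metric.ball (0 : ℂ) 1, Q z + 1 ≠ 0 := fun z hz h => by
    have := congrArg Complex.re h
    have := hpos z hz
    simp at *
    linarith
  have hq : ∀ v : ℂ, ‖v - 1‖ ^ 2 = ‖v + 1‖ ^ 2 - 4 * v.re := fun v => by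
    simp only [Complex.sq_norm, Complex.normSq_apply, Complex.sub_re, Complex.sub_im,
      Complex.add_re, Complex.add_im, Complex.one_re, Complex.one_im]
    ring
  have hh : IsHolomorphicSelfMap (fun z => (Q z - 1) / (Q z + 1)) := by
    refine ⟨(hQ.sub_const 1).div (hQ.add_const 1) hne, fun z hz => ?_⟩
    have h0 := norm_pos_iff.2 (hne z hz)
    rw [mem_ball_zero_iff, norm_div, div_lt_one h0]
    refine lt_of_pow_lt_pow_left₀ 2 h0.le ?_
    have := hpos z hz
    rw [hq]
    linarith
  have key := hh.schwarz_pick hz hw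
  have hz1 := hne z hz
  have hw1 := hne w hw
  have hw2 : conj (Q w) + 1 ≠ 0 := fun h => hw1 (by simpa using congrArg conj h)
  have hzn := norm_pos_iff.2 hz1
  have hwn := norm_pos_iff.2 hw1
  have e1 : 1 - conj ((Q w - 1) / (Q w + 1)) * ((Q z - 1) / (Q z + 1)) =
      2 * (Q z + conj (Q w)) / ((Q z + 1) * (conj (Q w) + 1)) := by
    simp only [map_div₀, map_sub, map_add, map_one]
    field_simp
    ring
  have e2 : ‖conj (Q w) + 1‖ = ‖Q w + 1‖ := by
    rw [← Complex.norm_conj]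
    simp
  have e3 : ∀ v : ℂ, 0 < ‖v + 1‖ → 1 - ‖(v - 1) / (v + 1)‖ ^ 2 = 4 * v.re / ‖v + 1‖ ^ 2 := by
    intro v hv
    rw [norm_div, div_pow, hq]
    field_simp
    ring
  rw [e1, e3 _ hzn, e3 _ hwn, norm_div, norm_mul, norm_mul, e2] at key
  have e4 : (‖(2 : ℂ)‖ * ‖Q z + conj (Q w)‖ / (‖Q z + 1‖ * ‖Q w + 1‖)) ^ 2 *
      ((1 - ‖z‖ ^ 2) * (1 - ‖w‖ ^ 2)) = 4 / (‖Q z + 1‖ * ‖Q w + 1‖) ^ 2 *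
      (‖Q z + conj (Q w)‖ ^ 2 * ((1 - ‖z‖ ^ 2) * (1 - ‖w‖ ^ 2))) := by
    simp only [Complex.norm_ofNat]
    ring
  have e5 : ‖1 - conj w * z‖ ^ 2 *
      (4 * (Q z).re / ‖Q z + 1‖ ^ 2 * (4 * (Q w).re / ‖Q w + 1‖ ^ 2)) =
      4 / (‖Q z + 1‖ * ‖Q w + 1‖) ^ 2 * (‖1 - conj w * z‖ ^ 2 * (4 * (Q z).re * (Q w).re)) := by
    field_simp
  rw [e4, e5] at key
  exact le_of_mul_le_mul_left key (by positivity)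

open ComplexConjugate in
/-- The **Schwarz-Pick lemma** for holomorphic functions from the disc to the closed right
half-plane. -/
theorem schwarz_pick_of_re_nonneg {Q : ℂ → ℂ} (hQ : DifferentiableOn ℂ Q (Metric.ball 0 1))
    (hnn : ∀ z ∈ Metric.ball (0 : ℂ) 1, 0 ≤ (Q z).re) {z w : ℂ}
    (hz : z ∈ Metric.ball (0 : ℂ) 1) (hw : w ∈ Metric.ball (0 : ℂ) 1) :
    ‖Q z + conj (Q w)‖ ^ 2 * ((1 - ‖z‖ ^ 2) * (1 - ‖w‖ ^ 2)) ≤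
      ‖1 - conj w * z‖ ^ 2 * (4 * (Q z).re * (Q w).re) := by
  -- Adding δ > 0 to `Q` makes the real part strictly positive; both sides are continuous in δ.
  let L : ℝ → ℝ := fun δ =>
    ‖(Q z + δ) + conj (Q w + δ)‖ ^ 2 * ((1 - ‖z‖ ^ 2) * (1 - ‖w‖ ^ 2))
  let R : ℝ → ℝ := fun δ =>
    ‖1 - conj w * z‖ ^ 2 * (4 * (Q z + δ).re * (Q w + δ).re)
  have hL : Continuous L := by fun_prop
  have hR : Continuous R := by fun_prop
  have hle : ∀ᶠ δ in 𝓝[>] (0 : ℝ), L δ ≤ R δ := by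
    filter_upwards [self_mem_nhdsWithin] with δ hδ
    refine schwarz_pick_of_re_pos (Q := fun z => Q z + δ) (hQ.add_const _) (fun v hv => ?_) hz hw
    have := hnn v hv
    have : 0 < δ := hδ
    simp
    linarith
  have := le_of_tendsto_of_tendsto (hL.continuousAt (x := 0).tendsto.mono_left nhdsWithin_le_nhds)
    (hR.continuousAt (x := 0).tendsto.mono_left nhdsWithin_le_nhds) hle
  simpa [L, R] using this

-- Infinitesimal Schwarz-Pick: a common term cancels from the two-point inequality, which is then
-- divided by |z-w|² as z → w.
open ComplexConjugate in
theorem norm_deriv_le_of_re_nonneg {Q : ℂ → ℂ} (hQ : DifferentiableOn ℂ Q (Metric.ball 0 1))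
    (hnn : ∀ z ∈ Metric.ball (0 : ℂ) 1, 0 ≤ (Q z).re) {w : ℂ}
    (hw : w ∈ Metric.ball (0 : ℂ) 1) :
    ‖deriv Q w‖ * (1 - ‖w‖ ^ 2) ≤ 2 * (Q w).re := by
  have hd : DifferentiableAt ℂ Q w := hQ.differentiableAt (Metric.isOpen_ball.mem_nhds hw)
  have hs := (hasDerivAt_iff_tendsto_slope.1 hd.hasDerivAt).norm.pow 2
  have hid : Tendsto (fun z : ℂ => z) (𝓝[≠] w) (𝓝 w) := nhdsWithin_le_nhds
  have hQc : Tendsto Q (𝓝[≠] w) (𝓝 (Q w)) := hd.continuousAt.tendsto.mono_left nhdsWithin_le_nhds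
  have hl := hs.mul (((hid.norm.pow 2).const_sub 1).mul_const (1 - ‖w‖ ^ 2))
  have hr := ((Complex.continuous_re.tendsto _).comp hQc).const_mul 4 |>.mul_const (Q w).re
  have hle := le_of_tendsto_of_tendsto hl hr (by
    filter_upwards [self_mem_nhdsWithin, nhdsWithin_le_nhds (Metric.isOpen_ball.mem_nhds hw)]
      with z hzw hz
    have key := schwarz_pick_of_re_nonneg hQ hnn hz hw
    have e1 : ‖Q z + conj (Q w)‖ ^ 2 = ‖Q z - Q w‖ ^ 2 + 4 * (Q z).re * (Q w).re := by
      simp only [Complex.sq_norm, Complex.normSq_apply, Complex.sub_re, Complex.sub_im,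
        Complex.add_re, Complex.add_im, Complex.conj_re, Complex.conj_im]
      ring
    rw [e1, norm_sq_one_sub_conj_mul] at key
    have h0 : 0 < ‖z - w‖ := norm_pos_iff.2 (sub_ne_zero.2 hzw)
    rw [slope_def_field, norm_div, div_pow, div_mul_eq_mul_div, div_le_iff₀ (by positivity)]
    simp only [Function.comp]
    linarith)
  have h1 := sub_pos.2 (norm_sq_lt_one hw)
  refine (le_abs_self _).trans (abs_le_of_sq_le_sq ?_ (by linarith [hnn w hw]))
  linarith

/-! ### Cayley transform and horodiscs -/

/-- The Cayley transform, from the unit disc onto the right half-plane, sending `1` to infinity. -/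
noncomputable def cayley (z : ℂ) : ℂ := (1 + z) / (1 - z)

theorem one_sub_ne_zero_of_mem_ball {z : ℂ} (hz : z ∈ Metric.ball (0 : ℂ) 1) : 1 - z ≠ 0 := by
  intro h
  rw [← sub_eq_zero.1 h] at hz
  simp at hz

theorem cayley_re (z : ℂ) : (cayley z).re = (1 - ‖z‖ ^ 2) / ‖1 - z‖ ^ 2 := by
  rw [cayley, Complex.div_re, ← add_div, Complex.sq_norm, Complex.sq_norm]
  congr 1
  simp only [Complex.normSq_apply, Complex.sub_re, Complex.sub_im, Complex.add_re, Complex.add_im,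
    Complex.one_re, Complex.one_im]
  ring

theorem cayley_re_pos {z : ℂ} (hz : z ∈ Metric.ball (0 : ℂ) 1) : 0 < (cayley z).re := by
  rw [cayley_re]
  have := norm_pos_iff.2 (one_sub_ne_zero_of_mem_ball hz)
  have := sub_pos.2 (norm_sq_lt_one hz)
  positivity

theorem cayley_eq {z : ℂ} (hz : 1 - z ≠ 0) : cayley z = 2 / (1 - z) - 1 := by
  rw [cayley]
  field_simp
  ring

theorem one_sub_eq_two_div {z : ℂ} (hz : 1 - z ≠ 0) : 1 - z = 2 / (cayley z + 1) := by
  rw [cayley_eq hz]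
  field_simp
  ring

theorem cayley_injOn : InjOn cayley (Metric.ball 0 1) := fun z hz w hw h => by
  have h1 := one_sub_eq_two_div (one_sub_ne_zero_of_mem_ball hz)
  rw [h, ← one_sub_eq_two_div (one_sub_ne_zero_of_mem_ball hw)] at h1
  linear_combination -h1

theorem hasDerivAt_cayley {z : ℂ} (hz : 1 - z ≠ 0) : HasDerivAt cayley (2 / (1 - z) ^ 2) z := by
  have := ((hasDerivAt_id z).const_add 1).div ((hasDerivAt_id z).const_sub 1) hz
  refine this.congr_deriv ?_
  simp only [id]
  congr 1
  ring

theorem differentiableOn_cayley : DifferentiableOn ℂ cayley (Metric.ball 0 1) := fun _ hz =>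
  (hasDerivAt_cayley (one_sub_ne_zero_of_mem_ball hz)).differentiableAt.differentiableWithinAt

/-- The Julia inequality at the point `1` with coefficient `1`: the map `φ` sends every horodisc
at `1` into itself. -/
def PreservesHorodiscs (φ : ℂ → ℂ) : Prop :=
  ∀ z ∈ Metric.ball (0 : ℂ) 1, (cayley z).re ≤ (cayley (φ z)).re

namespace IsHolomorphicSelfMap

variable {φ : ℂ → ℂ}

/-- With denominators cleared, the condition is the form that Schwarz-Pick takes as its second point
tends to 1. -/
theorem preservesHorodiscs_iff (hφ : IsHolomorphicSelfMap φ) :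
    PreservesHorodiscs φ ↔ ∀ z ∈ Metric.ball (0 : ℂ) 1,
      ‖1 - φ z‖ ^ 2 * (1 - ‖z‖ ^ 2) ≤ ‖1 - z‖ ^ 2 * (1 - ‖φ z‖ ^ 2) := by
  refine forall₂_congr fun z hz => ?_
  have h1 := one_sub_ne_zero_of_mem_ball hz
  have h2 := one_sub_ne_zero_of_mem_ball (hφ.mapsTo hz)
  have := norm_pos_iff.2 h1
  have := norm_pos_iff.2 h2
  rw [cayley_re, cayley_re, div_le_div_iff₀ (by positivity) (by positivity),
    mul_comm, mul_comm (‖1 - z‖ ^ 2)]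

theorem isSchur_iff_preservesHorodiscs (hφ : IsHolomorphicSelfMap φ) {α : ℝ} (hα : 0 < α) :
    IsSchur (fun z => atomicInner α (φ z) / atomicInner α z) ↔ PreservesHorodiscs φ := by
  have e : ∀ z, atomicInner α z = Complex.exp (-(α * cayley z)) := fun z => by
    rw [atomicInner, cayley, ← neg_sub 1 z, div_neg, mul_neg, add_comm]
  have hn : ∀ z, ‖atomicInner α (φ z) / atomicInner α z‖ =
      Real.exp (α * ((cayley z).re - (cayley (φ z)).re)) := fun z => by
    rw [e, e, ← Complex.exp_sub, Complex.norm_exp]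
    congr 1
    simp only [Complex.sub_re, Complex.neg_re, Complex.re_ofReal_mul]
    ring
  constructor
  · intro h z hz
    have := h.norm_le_one z hz
    rw [hn, Real.exp_le_one_iff] at this
    linarith [nonpos_of_mul_nonpos_right this hα]
  · intro h
    refine ⟨?_, fun z hz => ?_⟩
    · simp only [e]
      refine DifferentiableOn.div ?_ ?_ fun _ _ => Complex.exp_ne_zero _
      · exact ((differentiableOn_cayley.comp hφ.differentiableOn hφ.mapsTo).const_mul _).neg.cexp
      · exact (differentiableOn_cayley.const_mul _).neg.cexp
    · rw [hn, Real.exp_le_one_iff]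
      exact mul_nonpos_of_nonneg_of_nonpos hα.le (by linarith [h z hz])

/-! ### Julia's lemma, from radial limits and from iterates -/

theorem ofReal_mem_ball {r : ℝ} (h0 : 0 ≤ r) (h1 : r < 1) :
    (r : ℂ) ∈ Metric.ball (0 : ℂ) 1 := by
  simpa [abs_of_nonneg h0] using h1

theorem eventually_mem_Ioo : ∀ᶠ r in 𝓝[<] (1 : ℝ), r ∈ Ioo (0 : ℝ) 1 :=
  Ioo_mem_nhdsLT zero_lt_one

theorem tendsto_ofReal_one : Tendsto (fun r : ℝ => (r : ℂ)) (𝓝[<] 1) (𝓝 1) := by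
  have := (Complex.continuous_ofReal.tendsto 1).mono_left (nhdsWithin_le_nhds (s := Iio 1))
  simpa using this

/-- The radial limit of the difference quotient is the radial limit of the derivative. -/
theorem tendsto_one_sub_div (hφ : IsHolomorphicSelfMap φ) (hfix : IsRadialFixedPoint φ 1) {d : ℂ}
    (hd : HasRadialDeriv φ 1 d) :
    Tendsto (fun r : ℝ => (1 - φ r) / (1 - r)) (𝓝[<] 1) (𝓝 d) := by
  simp only [IsRadialFixedPoint, HasRadialDeriv, mul_one] at hfix hd
  -- The value of φ at 1 is arbitrary, so it is replaced by the radial limit to obtain continuity up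
  -- to the endpoint.
  let g : ℝ → ℂ := Function.update (fun r : ℝ => φ r) 1 1
  have hg : ∀ r : ℝ, r < 1 → g r = φ r := fun r hr => Function.update_of_ne hr.ne _ _
  have hder : ∀ r ∈ Ioo (0 : ℝ) 1, HasDerivAt g (deriv φ r) r := fun r hr => by
    have h1 : DifferentiableAt ℂ φ r := hφ.differentiableOn.differentiableAt
      (Metric.isOpen_ball.mem_nhds (ofReal_mem_ball hr.1.le hr.2))
    refine h1.hasDerivAt.comp_ofReal.congr_of_eventuallyEq ?_
    filter_upwards [Iio_mem_nhds hr.2] with t ht using hg t ht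
  have hev : ∀ᶠ r in 𝓝[<] (1 : ℝ), r < 1 := self_mem_nhdsWithin
  have hgd : HasDerivWithinAt g d (Iic 1) 1 := by
    refine hasDerivWithinAt_Iic_of_tendsto_deriv (s := Ioo 0 1)
      (fun r hr => (hder r hr).differentiableAt.differentiableWithinAt) ?_
      (Ioo_mem_nhdsLT zero_lt_one) ?_
    · have : Tendsto g (𝓝[<] 1) (𝓝 (g 1)) := by
        simp only [g, Function.update_self]
        refine hfix.congr' ?_
        filter_upwards [hev] with r hr using (hg r hr).symm
      exact this.mono_left (nhdsWithin_mono _ Ioo_subset_Iio_self)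
    · refine hd.congr' ?_
      filter_upwards [eventually_mem_Ioo] with r hr using (hder r hr).deriv.symm
  have := (hasDerivWithinAt_iff_tendsto_slope.1 hgd)
  rw [show Iic (1 : ℝ) \ {1} = Iio 1 from Iic_sdiff_right] at this
  refine this.congr' ?_
  filter_upwards [hev] with r hr
  have h1 : (1 - r : ℂ) ≠ 0 := by
    rw [sub_ne_zero]
    exact_mod_cast hr.ne'
  have h2 : (r - 1 : ℝ) ≠ 0 := by linarith
  have h3 : (r - 1 : ℂ) ≠ 0 := by exact_mod_cast h2
  rw [slope_def_module, hg r hr, Complex.real_smul]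
  simp only [g, Function.update_self]
  push_cast
  field_simp
  ring

open ComplexConjugate in
/-- **Julia's lemma** at the point `1`. -/
theorem preservesHorodiscs_of_hasRadialDeriv (hφ : IsHolomorphicSelfMap φ)
    (hfix : IsRadialFixedPoint φ 1) {d : ℝ} (hd : HasRadialDeriv φ 1 (d : ℂ)) (hd1 : d ≤ 1) :
    PreservesHorodiscs φ := by
  have hq := hφ.tendsto_one_sub_div hfix hd
  simp only [IsRadialFixedPoint, mul_one] at hfix
  have hball : ∀ᶠ r : ℝ in 𝓝[<] 1, (r : ℂ) ∈ Metric.ball (0 : ℂ) 1 :=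
    eventually_mem_Ioo.mono fun r hr => ofReal_mem_ball hr.1.le hr.2
  have hd0 : 0 ≤ d := by
    have hre := (Complex.continuous_re.tendsto _).comp hq
    rw [Complex.ofReal_re] at hre
    refine ge_of_tendsto hre ?_
    filter_upwards [eventually_mem_Ioo, hball] with r hr hrb
    have h1 := (Complex.re_le_norm (φ r)).trans (mem_ball_zero_iff.1 (hφ.mapsTo hrb)).le
    have : (1 - φ r) / (1 - r) = (1 - φ r) / ((1 - r : ℝ) : ℂ) := by push_cast; rfl
    rw [Function.comp, this, Complex.div_ofReal_re]
    refine div_nonneg ?_ (by linarith [hr.2])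
    simpa using h1
  rw [hφ.preservesHorodiscs_iff]
  intro z hz
  have hl : Tendsto (fun r : ℝ => ‖1 - conj (φ r) * φ z‖ ^ 2 * ((1 - ‖z‖ ^ 2) * (1 + r))) (𝓝[<] 1)
      (𝓝 (‖1 - conj 1 * φ z‖ ^ 2 * ((1 - ‖z‖ ^ 2) * (1 + 1)))) := by
    refine Tendsto.mul ?_ ?_
    · exact (((((Complex.continuous_conj.tendsto _).comp hfix).mul_const _).const_sub 1).norm).pow 2
    · exact ((tendsto_id.mono_left nhdsWithin_le_nhds).const_add 1).const_mul _
  have hr : Tendsto (fun r : ℝ => ‖1 - conj (r : ℂ) * z‖ ^ 2 *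
      ((1 - ‖φ z‖ ^ 2) * (2 * ‖(1 - φ r) / (1 - r)‖))) (𝓝[<] 1)
      (𝓝 (‖1 - conj 1 * z‖ ^ 2 * ((1 - ‖φ z‖ ^ 2) * (2 * ‖(d : ℂ)‖)))) := by
    refine Tendsto.mul ?_ ?_
    · exact (((((Complex.continuous_conj.tendsto _).comp tendsto_ofReal_one).mul_const
        _).const_sub 1).norm).pow 2
    · exact (hq.norm.const_mul 2).const_mul _
  have hz1 := sub_pos.2 (norm_sq_lt_one (hφ.mapsTo hz))
  have hle := le_of_tendsto_of_tendsto hl hr (by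
    filter_upwards [eventually_mem_Ioo, hball] with r hr hrb
    have key := hφ.schwarz_pick hz hrb
    have hr1 : 0 < 1 - r := by linarith [hr.2]
    have e0 : ‖(r : ℂ)‖ = r := by rw [Complex.norm_real, Real.norm_of_nonneg hr.1.le]
    have e1 : ‖(1 - r : ℂ)‖ = 1 - r := by
      rw [← Complex.ofReal_one, ← Complex.ofReal_sub, Complex.norm_real, Real.norm_of_nonneg hr1.le]
    -- The factor 2 bounds 1 + |φ(r)|; it cancels in the limit against 1 + r, which comes from 1 -
    -- r².
    have h1 : 1 - ‖φ r‖ ^ 2 ≤ 2 * ‖1 - φ r‖ := by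
      have h2 := norm_sub_norm_le 1 (φ r)
      have h3 := mem_ball_zero_iff.1 (hφ.mapsTo hrb)
      rw [norm_one] at h2
      nlinarith [norm_nonneg (φ r)]
    rw [norm_div, e1]
    rw [e0] at key
    have h4 : ‖1 - conj (r : ℂ) * z‖ ^ 2 * ((1 - ‖φ z‖ ^ 2) * (1 - ‖φ r‖ ^ 2)) ≤
        ‖1 - conj (r : ℂ) * z‖ ^ 2 * ((1 - ‖φ z‖ ^ 2) * (2 * ‖1 - φ r‖)) := by gcongr
    have h5 := key.trans h4
    rw [← mul_div_assoc, ← mul_div_assoc, ← mul_div_assoc, le_div_iff₀ hr1]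
    linarith)
  simp only [map_one, one_mul, Complex.norm_real, Real.norm_of_nonneg hd0] at hle
  have : ‖1 - z‖ ^ 2 * ((1 - ‖φ z‖ ^ 2) * (2 * d)) ≤
      ‖1 - z‖ ^ 2 * ((1 - ‖φ z‖ ^ 2) * (2 * 1)) := by gcongr
  linarith

open ComplexConjugate in
/-- If the iterates of a point converge to `1`, then horodiscs at `1` are preserved. -/
theorem preservesHorodiscs_of_tendsto_iterate (hφ : IsHolomorphicSelfMap φ) {z₀ : ℂ}
    (hz₀ : z₀ ∈ Metric.ball (0 : ℂ) 1) (h : Tendsto (fun n : ℕ => φ^[n] z₀) atTop (𝓝 1)) :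
    PreservesHorodiscs φ := by
  rw [hφ.preservesHorodiscs_iff]
  intro z hz
  have hmem : ∀ n, φ^[n] z₀ ∈ Metric.ball (0 : ℂ) 1 := fun n => hφ.mapsTo.iterate n hz₀
  let u : ℕ → ℝ := fun n => 1 - ‖φ^[n] z₀‖ ^ 2
  have hu : ∀ n, 0 < u n := fun n => sub_pos.2 (norm_sq_lt_one (hmem n))
  have hu0 : Tendsto u atTop (𝓝 0) := by
    have := (h.norm.pow 2).const_sub 1
    simpa using this
  -- A positive sequence tending to 0 cannot be eventually increasing. At indices with u(n+1) ≤
  -- u(n), Schwarz-Pick for the pair `z`, `φ^[n] z₀` yields the coefficient 1.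
  have hfreq : ∃ᶠ n in atTop, u (n + 1) ≤ u n := by
    rw [frequently_atTop]
    intro N
    by_contra! hcon
    have hmono : ∀ k, u N ≤ u (N + k) := fun k => by
      induction k with
      | zero => rfl
      | succ k ih => exact ih.trans (hcon (N + k) (by omega)).le
    have := (tendsto_order.1 hu0).2 (u N) (hu N)
    obtain ⟨M, hM⟩ := eventually_atTop.1 this
    have h1 := hM (N + M) (by omega)
    linarith [hmono M]
  obtain ⟨ns, hns, hle⟩ := extraction_of_frequently_atTop hfreq
  have hz1 : Tendsto (fun k => φ^[ns k] z₀) atTop (𝓝 1) := h.comp hns.tendsto_atTop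
  have hz2 : Tendsto (fun k => φ (φ^[ns k] z₀)) atTop (𝓝 1) := by
    have := ((tendsto_add_atTop_iff_nat 1).2 h).comp hns.tendsto_atTop
    simpa only [Function.comp_def, Function.iterate_succ_apply'] using this
  have hlim : ∀ {f : ℕ → ℂ} (v : ℂ), Tendsto f atTop (𝓝 1) →
      Tendsto (fun k => ‖1 - conj (f k) * v‖ ^ 2) atTop (𝓝 (‖1 - v‖ ^ 2)) := fun {f} v hf => by
    have := (((((Complex.continuous_conj.tendsto _).comp hf).mul_const v).const_sub 1).norm).pow 2
    simpa using this
  refine le_of_tendsto_of_tendsto ((hlim (φ z) hz2).mul_const _) ((hlim z hz1).mul_const _) ?_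
  refine Eventually.of_forall fun k => ?_
  have key := hφ.schwarz_pick hz (hmem (ns k))
  have h1 := hle k
  have h2 := hu (ns k)
  simp only [u, Function.iterate_succ_apply'] at h1 h2
  have h3 := sub_pos.2 (norm_sq_lt_one (hφ.mapsTo hz))
  have h4 := key.trans (mul_le_mul_of_nonneg_left (mul_le_mul_of_nonneg_left h1 h3.le)
    (sq_nonneg _))
  rw [← mul_assoc, ← mul_assoc] at h4
  exact le_of_mul_le_mul_right h4 h2

end IsHolomorphicSelfMap

/-! ### Radial growth of functions with nonnegative real part -/

open ComplexConjugate in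
/-- A holomorphic function with nonnegative real part on the disc grows at most like
`1 / (1 - r)` towards `1`, with a constant controlled by each of its values. -/
theorem tendsto_one_sub_mul_of_re_nonneg {Q : ℂ → ℂ} (hQ : DifferentiableOn ℂ Q (Metric.ball 0 1))
    (hnn : ∀ z ∈ Metric.ball (0 : ℂ) 1, 0 ≤ (Q z).re)
    (hsmall : ∀ ε > 0, ∃ z ∈ Metric.ball (0 : ℂ) 1, (Q z).re ≤ ε * (cayley z).re) :
    Tendsto (fun r : ℝ => (1 - r : ℂ) * Q r) (𝓝[<] 1) (𝓝 0) := by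
  rw [NormedAddGroup.tendsto_nhds_zero]
  intro ε hε
  -- The bound `g` below has g(1) = 2 Re Q(w) / Re C(w), so ε/4 gives g(1) ≤ ε/2.
  obtain ⟨w, hw, hwε⟩ := hsmall (ε / 4) (by positivity)
  have hw1 := sub_pos.2 (norm_sq_lt_one hw)
  have hw2 := norm_pos_iff.2 (one_sub_ne_zero_of_mem_ball hw)
  let g : ℝ → ℝ := fun r =>
    ‖1 - conj w * r‖ ^ 2 * (4 * (Q w).re) / ((1 + r) * (1 - ‖w‖ ^ 2)) + (1 - r) * ‖Q w‖
  have hg : ContinuousAt g 1 := by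
    have : (1 + 1 : ℝ) * (1 - ‖w‖ ^ 2) ≠ 0 := by positivity
    fun_prop (disch := assumption)
  have hg1 : g 1 < ε := by
    have e : ‖1 - conj w‖ = ‖1 - w‖ := by
      rw [← Complex.norm_conj]
      simp
    rw [cayley_re, mul_div_assoc', le_div_iff₀ (by positivity)]
      at hwε
    simp only [g, Complex.ofReal_one, mul_one, e, sub_self, zero_mul, add_zero]
    rw [div_lt_iff₀ (by positivity)]
    nlinarith [mul_pos hε hw1]
  filter_upwards [IsHolomorphicSelfMap.eventually_mem_Ioo,
    (hg.tendsto.mono_left nhdsWithin_le_nhds).eventually (gt_mem_nhds hg1)] with r hr hgr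
  refine lt_of_le_of_lt ?_ hgr
  have hrb := IsHolomorphicSelfMap.ofReal_mem_ball hr.1.le hr.2
  have hr1 : 0 < 1 - r := by linarith [hr.2]
  have hr2 : 0 < 1 + r := by linarith [hr.1]
  have e1 : ‖(1 - r : ℂ)‖ = 1 - r := by
    rw [← Complex.ofReal_one, ← Complex.ofReal_sub, Complex.norm_real, Real.norm_of_nonneg hr1.le]
  have e0 : ‖(r : ℂ)‖ = r := by rw [Complex.norm_real, Real.norm_of_nonneg hr.1.le]
  have key := schwarz_pick_of_re_nonneg hQ hnn hrb hw
  rw [e0] at key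
  have hre : (Q r).re ≤ ‖Q r + conj (Q w)‖ := by
    refine le_trans ?_ (Complex.re_le_norm _)
    simpa using hnn w hw
  have hN : (1 - r) * ‖Q r + conj (Q w)‖ ≤
      ‖1 - conj w * r‖ ^ 2 * (4 * (Q w).re) / ((1 + r) * (1 - ‖w‖ ^ 2)) := by
    rw [le_div_iff₀ (by positivity)]
    rcases (norm_nonneg (Q r + conj (Q w))).eq_or_lt with h0 | h0
    · rw [← h0]
      have := hnn w hw
      simp only [mul_zero, zero_mul]
      positivity
    · refine le_of_mul_le_mul_right ?_ h0
      calc _ = ‖Q r + conj (Q w)‖ ^ 2 * ((1 - r ^ 2) * (1 - ‖w‖ ^ 2)) := by ring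
        _ ≤ _ := key
        _ = ‖1 - conj w * r‖ ^ 2 * (4 * (Q w).re) * (Q r).re := by ring
        _ ≤ _ := mul_le_mul_of_nonneg_left hre (by have := hnn w hw; positivity)
  have htri : ‖Q r‖ ≤ ‖Q r + conj (Q w)‖ + ‖Q w‖ := by
    have := norm_sub_le (Q r + conj (Q w)) (conj (Q w))
    rwa [add_sub_cancel_right, Complex.norm_conj] at this
  rw [norm_mul, e1]
  calc (1 - r) * ‖Q r‖ ≤ (1 - r) * (‖Q r + conj (Q w)‖ + ‖Q w‖) := by gcongr
    _ ≤ g r := by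
      simp only [g]
      linarith

/-- The derivative of a function as in `tendsto_one_sub_mul_of_re_nonneg` satisfies the
corresponding growth bound. -/
theorem tendsto_one_sub_sq_mul_deriv {Q : ℂ → ℂ} (hQ : DifferentiableOn ℂ Q (Metric.ball 0 1))
    (hnn : ∀ z ∈ Metric.ball (0 : ℂ) 1, 0 ≤ (Q z).re)
    (hlim : Tendsto (fun r : ℝ => (1 - r : ℂ) * Q r) (𝓝[<] 1) (𝓝 0)) :
    Tendsto (fun r : ℝ => (1 - r : ℂ) ^ 2 * deriv Q r) (𝓝[<] 1) (𝓝 0) := by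
  have hlim2 := hlim.norm.const_mul 2
  rw [norm_zero, mul_zero] at hlim2
  refine squeeze_zero_norm' ?_ hlim2
  filter_upwards [IsHolomorphicSelfMap.eventually_mem_Ioo] with r hr
  have hrb := IsHolomorphicSelfMap.ofReal_mem_ball hr.1.le hr.2
  have hr1 : 0 < 1 - r := by linarith [hr.2]
  have e1 : ‖(1 - r : ℂ)‖ = 1 - r := by
    rw [← Complex.ofReal_one, ← Complex.ofReal_sub, Complex.norm_real, Real.norm_of_nonneg hr1.le]
  have e0 : ‖(r : ℂ)‖ = r := by rw [Complex.norm_real, Real.norm_of_nonneg hr.1.le]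
  have key := norm_deriv_le_of_re_nonneg hQ hnn hrb
  rw [e0] at key
  have h1 := Complex.re_le_norm (Q r)
  have h2 : ‖deriv Q r‖ * (1 - r) ≤ ‖deriv Q r‖ * (1 - r ^ 2) := by
    refine mul_le_mul_of_nonneg_left ?_ (norm_nonneg _)
    nlinarith [hr.1, hr.2]
  rw [norm_mul, norm_mul, norm_pow, e1]
  nlinarith [norm_nonneg (deriv Q r)]

/-! ### Existence of the radial derivative -/

namespace IsHolomorphicSelfMap

variable {φ : ℂ → ℂ}

theorem differentiableOn_cayley_comp (hφ : IsHolomorphicSelfMap φ) :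
    DifferentiableOn ℂ (fun z => cayley (φ z)) (Metric.ball 0 1) :=
  differentiableOn_cayley.comp hφ.differentiableOn hφ.mapsTo

/-- The **Julia-Wolff-Carathéodory theorem** at the point `1`, for maps preserving horodiscs. -/
theorem exists_hasRadialDeriv (hφ : IsHolomorphicSelfMap φ) (hJ : PreservesHorodiscs φ) :
    IsRadialFixedPoint φ 1 ∧ ∃ d : ℝ, HasRadialDeriv φ 1 (d : ℂ) ∧ d ≤ 1 := by
  -- The infimum c of `ρ` makes 1 + c the best constant in Re C∘φ ≥ (1+c) Re C: a lower bound gives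
  -- Re Q ≥ 0, the greatest one gives `hsmall`.
  let ρ : ℂ → ℝ := fun z => ((cayley (φ z)).re - (cayley z).re) / (cayley z).re
  let S : Set ℝ := ρ '' Metric.ball 0 1
  have hS0 : ∀ x ∈ S, 0 ≤ x := by
    rintro _ ⟨z, hz, rfl⟩
    exact div_nonneg (sub_nonneg.2 (hJ z hz)) (cayley_re_pos hz).le
  have hSne : S.Nonempty := (Metric.nonempty_ball.2 one_pos).image _
  let c : ℝ := sInf S
  have hc : 0 ≤ c := Real.sInf_nonneg hS0
  let Q : ℂ → ℂ := fun z => cayley (φ z) - (1 + c) * cayley z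
  have hQre : ∀ z, (Q z).re = (cayley (φ z)).re - (1 + c) * (cayley z).re := fun z => by
    simp only [Q]
    rw [← Complex.ofReal_one, ← Complex.ofReal_add, Complex.sub_re, Complex.re_ofReal_mul]
  have hQd : DifferentiableOn ℂ Q (Metric.ball 0 1) :=
    hφ.differentiableOn_cayley_comp.sub (differentiableOn_cayley.const_mul _)
  have hQnn : ∀ z ∈ Metric.ball (0 : ℂ) 1, 0 ≤ (Q z).re := fun z hz => by
    have h1 : c ≤ ρ z := csInf_le ⟨0, hS0⟩ (mem_image_of_mem _ hz)
    rw [le_div_iff₀ (cayley_re_pos hz)] at h1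
    rw [hQre]
    linarith
  have hsmall : ∀ ε > 0, ∃ z ∈ Metric.ball (0 : ℂ) 1, (Q z).re ≤ ε * (cayley z).re := by
    intro ε hε
    obtain ⟨_, ⟨z, hz, rfl⟩, hlt⟩ := exists_lt_of_csInf_lt hSne (lt_add_of_pos_right c hε)
    refine ⟨z, hz, ?_⟩
    rw [div_lt_iff₀ (cayley_re_pos hz)] at hlt
    rw [hQre]
    linarith
  have hlim := tendsto_one_sub_mul_of_re_nonneg hQd hQnn hsmall
  have hlim' := tendsto_one_sub_sq_mul_deriv hQd hQnn hlim
  have hc1 : (1 + c : ℂ) ≠ 0 := by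
    have : (1 + c : ℝ) ≠ 0 := by positivity
    exact_mod_cast this
  have hone := tendsto_ofReal_one
  have hquot : Tendsto (fun r : ℝ => (1 - φ r) / (1 - r)) (𝓝[<] 1) (𝓝 (1 / (1 + c))) := by
    -- This is 1 - φ = 2/(C∘φ + 1) with C∘φ = Q + (1+c)C and (1-r)C(r) = 1 + r.
    have h1 : Tendsto (fun r : ℝ => (2 : ℂ) / ((1 - r) * Q r + (1 + c) * (1 + r) + (1 - r)))
        (𝓝[<] 1) (𝓝 (2 / (0 + (1 + c) * (1 + 1) + (1 - 1)))) := by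
      refine Tendsto.div tendsto_const_nhds ((hlim.add ((hone.const_add 1).const_mul _)).add
        (hone.const_sub 1)) ?_
      rw [zero_add, sub_self, add_zero]
      exact mul_ne_zero hc1 (by norm_num)
    have e : (2 : ℂ) / (0 + (1 + c) * (1 + 1) + (1 - 1)) = 1 / (1 + c) := by
      field_simp
      ring
    rw [e] at h1
    refine h1.congr' ?_
    filter_upwards [eventually_mem_Ioo] with r hr
    have hrb := ofReal_mem_ball hr.1.le hr.2
    have h2 := one_sub_ne_zero_of_mem_ball hrb
    have h3 := one_sub_ne_zero_of_mem_ball (hφ.mapsTo hrb)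
    have e2 : (1 - r : ℂ) * Q r + (1 + c) * (1 + r) + (1 - r) = 2 * (1 - r) / (1 - φ r) := by
      simp only [Q]
      rw [cayley_eq h3, cayley]
      field_simp
      ring
    rw [e2]
    field_simp
  refine ⟨?_, 1 / (1 + c), ?_, ?_⟩
  · have h1 := (hquot.mul (hone.const_sub 1)).const_sub 1
    simp only [IsRadialFixedPoint, mul_one]
    rw [sub_self, mul_zero, sub_zero] at h1
    refine h1.congr' ?_
    filter_upwards [eventually_mem_Ioo] with r hr
    have h2 := one_sub_ne_zero_of_mem_ball (ofReal_mem_ball hr.1.le hr.2)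
    field_simp
    ring
  -- Differentiating C∘φ = Q + (1+c)C gives φ'(r) = ((1-φ(r))/(1-r))² (1 + c + (1-r)²Q'(r)/2).
  · have h1 := (hquot.pow 2).mul ((hlim'.div_const 2).const_add (1 + c : ℂ))
    simp only [HasRadialDeriv, mul_one]
    have e : (1 / (1 + c : ℂ)) ^ 2 * (1 + c + 0 / 2) = ((1 / (1 + c) : ℝ) : ℂ) := by
      push_cast
      field_simp
      ring
    rw [e] at h1
    refine h1.congr' ?_
    filter_upwards [eventually_mem_Ioo] with r hr
    have hrb := ofReal_mem_ball hr.1.le hr.2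
    have h2 := one_sub_ne_zero_of_mem_ball hrb
    have h3 := one_sub_ne_zero_of_mem_ball (hφ.mapsTo hrb)
    have hφd : HasDerivAt φ (deriv φ r) r :=
      (hφ.differentiableOn.differentiableAt (Metric.isOpen_ball.mem_nhds hrb)).hasDerivAt
    have hQ' : deriv Q r = 2 / (1 - φ r) ^ 2 * deriv φ r - (1 + c) * (2 / (1 - r) ^ 2) :=
      (((hasDerivAt_cayley h3).comp (r : ℂ) hφd).sub
        ((hasDerivAt_cayley h2).const_mul (1 + c : ℂ))).deriv
    rw [hQ']
    field_simp
    ring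
  · rw [div_le_one (by positivity)]
    linarith

/-! ### Convergence of the iterates -/

/-- If a map preserving horodiscs keeps some point on the boundary of its horodisc, then it is
a translation in the half-plane model. -/
theorem cayley_comp_eq_add_const (hφ : IsHolomorphicSelfMap φ) (hJ : PreservesHorodiscs φ) {w : ℂ}
    (hw : w ∈ Metric.ball (0 : ℂ) 1) (h : (cayley (φ w)).re = (cayley w).re) :
    ∃ κ : ℂ, ∀ z ∈ Metric.ball (0 : ℂ) 1, cayley (φ z) = cayley z + κ := by
  -- For Q = C∘φ - C with Re Q(w) = 0, the right side of Schwarz-Pick vanishes, forcing Q(z) = -conj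
  -- Q(w) for every z.
  refine ⟨-(starRingEnd ℂ) (cayley (φ w) - cayley w), fun z hz => ?_⟩
  have key := schwarz_pick_of_re_nonneg (Q := fun z => cayley (φ z) - cayley z)
    (hφ.differentiableOn_cayley_comp.sub differentiableOn_cayley)
    (fun v hv => by simpa using hJ v hv) hz hw
  have h0 : (cayley (φ w) - cayley w).re = 0 := by simp [h]
  simp only [h0, mul_zero] at key
  have hpos := mul_pos (sub_pos.2 (norm_sq_lt_one hz)) (sub_pos.2 (norm_sq_lt_one hw))
  have h1 := nonpos_of_mul_nonpos_left key hpos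
  have h2 := norm_eq_zero.1 (pow_eq_zero_iff two_ne_zero |>.1 (le_antisymm h1 (sq_nonneg _)))
  linear_combination h2

/-- The iterates of a map which preserves horodiscs at `1` and is not the identity converge
pointwise to `1`. -/
theorem tendsto_iterate (hφ : IsHolomorphicSelfMap φ) (hJ : PreservesHorodiscs φ)
    (hid : ¬ EqOn φ id (Metric.ball 0 1)) {z : ℂ} (hz : z ∈ Metric.ball (0 : ℂ) 1) :
    Tendsto (fun n : ℕ => φ^[n] z) atTop (𝓝 1) := by
  have hmem : ∀ n, φ^[n] z ∈ Metric.ball (0 : ℂ) 1 := fun n => hφ.mapsTo.iterate n hz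
  let u : ℕ → ℝ := fun n => (cayley (φ^[n] z)).re
  have hmono : Monotone u := monotone_nat_of_le_succ fun n => by
    simp only [u, Function.iterate_succ_apply']
    exact hJ _ (hmem n)
  refine tendsto_of_subseq_tendsto fun ns hns => ?_
  obtain ⟨ζ, hζ, ms, hms, hlim⟩ := (isCompact_closedBall (0 : ℂ) 1).tendsto_subseq
    fun n => Metric.ball_subset_closedBall (hmem (ns n))
  refine ⟨ms, ?_⟩
  suffices h : ζ = 1 by rwa [h] at hlim
  have hks : Tendsto (fun k => ns (ms k)) atTop atTop := hns.comp hms.tendsto_atTop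
  have hlim : Tendsto (fun k => φ^[ns (ms k)] z) atTop (𝓝 ζ) := hlim
  by_contra hne
  have hζ1 : 1 - ζ ≠ 0 := sub_ne_zero.2 (Ne.symm hne)
  have hC : Tendsto (fun k => cayley (φ^[ns (ms k)] z)) atTop (𝓝 (cayley ζ)) :=
    (hasDerivAt_cayley hζ1).continuousAt.tendsto.comp hlim
  have hu : Tendsto (fun k => u (ns (ms k))) atTop (𝓝 (cayley ζ).re) :=
    (Complex.continuous_re.tendsto _).comp hC
  -- Re C never drops below its initial positive value along the orbit, which keeps ζ off the unit
  -- circle.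
  have hpos : 0 < (cayley ζ).re := by
    refine lt_of_lt_of_le (cayley_re_pos hz) ?_
    exact ge_of_tendsto hu (Eventually.of_forall fun k => hmono (Nat.zero_le _))
  have hζb : ζ ∈ Metric.ball (0 : ℂ) 1 := by
    rw [cayley_re] at hpos
    have := norm_pos_iff.2 hζ1
    have h1 : 0 < 1 - ‖ζ‖ ^ 2 := (div_pos_iff_of_pos_right (by positivity)).1 hpos
    rw [mem_ball_zero_iff]
    nlinarith [norm_nonneg ζ]
  have hu' : Tendsto u atTop (𝓝 (cayley ζ).re) :=
    (tendsto_iff_tendsto_subseq_of_monotone hmono hks).2 hu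
  -- By monotonicity all of `u` converges, so the orbit shifted by one step has the same limiting
  -- real part.
  have hstep : (cayley (φ ζ)).re = (cayley ζ).re := by
    have hc : ContinuousAt (fun v => (cayley (φ v)).re) ζ :=
      Complex.continuous_re.continuousAt.comp
        (hφ.differentiableOn_cayley_comp.differentiableAt
          (Metric.isOpen_ball.mem_nhds hζb)).continuousAt
    have h1 : Tendsto (fun k => u (ns (ms k) + 1)) atTop (𝓝 (cayley (φ ζ)).re) := by
      simp only [u, Function.iterate_succ_apply']
      exact hc.tendsto.comp hlim
    exact tendsto_nhds_unique h1 (((tendsto_add_atTop_iff_nat 1).2 hu').comp hks)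
  obtain ⟨κ, hκ⟩ := hφ.cayley_comp_eq_add_const hJ hζb hstep
  have hiter : ∀ n : ℕ, cayley (φ^[n] z) = cayley z + n * κ := fun n => by
    induction n with
    | zero => simp
    | succ n ih =>
      rw [Function.iterate_succ_apply', hκ _ (hmem n), ih]
      push_cast
      ring
  -- C(z) + nκ converges along a subsequence with n → ∞; dividing by n kills κ.
  have hκ0 : κ = 0 := by
    have hinv : Tendsto (fun k => ((ns (ms k) : ℕ) : ℂ)⁻¹) atTop (𝓝 0) :=
      tendsto_inv_atTop_nhds_zero_nat.comp hks
    have h1 := hinv.mul (hC.sub_const (cayley z))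
    rw [zero_mul] at h1
    refine tendsto_nhds_unique (tendsto_const_nhds.congr' ?_) h1
    filter_upwards [hks.eventually_gt_atTop 0] with k hk
    have : ((ns (ms k) : ℕ) : ℂ) ≠ 0 := by exact_mod_cast hk.ne'
    rw [hiter]
    field_simp
    ring
  refine hid fun v hv => cayley_injOn (hφ.mapsTo hv) hv ?_
  rw [hκ v hv, hκ0, add_zero, id]

theorem iterate (hφ : IsHolomorphicSelfMap φ) (n : ℕ) : IsHolomorphicSelfMap φ^[n] :=
  ⟨hφ.differentiableOn.iterate hφ.mapsTo n, hφ.mapsTo.iterate n⟩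

/-- Pointwise convergence of the iterates in the disc is locally uniform. -/
theorem isDenjoyWolffPoint_of_tendsto (hφ : IsHolomorphicSelfMap φ) {w : ℂ}
    (hw : w ∈ Metric.closedBall (0 : ℂ) 1)
    (h : ∀ z ∈ Metric.ball (0 : ℂ) 1, Tendsto (fun n : ℕ => φ^[n] z) atTop (𝓝 w)) :
    IsDenjoyWolffPoint φ w := by
  refine ⟨hw, (tendstoLocallyUniformlyOn_iff_forall_isCompact Metric.isOpen_ball).1 ?_⟩
  rw [Metric.tendstoLocallyUniformlyOn_iff]
  intro ε hε z hz
  obtain ⟨R, hR, hRsub⟩ := Metric.isOpen_iff.1 Metric.isOpen_ball z hz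
  have hδ : 0 < min R (ε * R / 4) := by positivity
  refine ⟨Metric.ball z (min R (ε * R / 4)),
    mem_nhdsWithin_of_mem_nhds (Metric.ball_mem_nhds z hδ), ?_⟩
  filter_upwards [Metric.tendsto_nhds.1 (h z hz) (ε / 2) (by positivity)] with n hn v hv
  have hv' := lt_min_iff.1 (Metric.mem_ball.1 hv)
  have hit := hφ.iterate n
  -- The Schwarz lemma gives a Lipschitz constant independent of n, since every iterate has image of
  -- diameter at most 2; hence the radius εR/4.
  have hlip : dist (φ^[n] v) (φ^[n] z) ≤ 2 / R * dist v z := by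
    refine Complex.dist_le_div_mul_dist_of_mapsTo_ball (hit.differentiableOn.mono hRsub)
      (fun y hy => ?_) (Metric.mem_ball.2 hv'.1)
    have h1 := mem_ball_zero_iff.1 (hit.mapsTo (hRsub hy))
    have h2 := mem_ball_zero_iff.1 (hit.mapsTo hz)
    rw [Metric.mem_closedBall, dist_eq_norm]
    linarith [norm_sub_le (φ^[n] y) (φ^[n] z)]
  have hlt : 2 / R * dist v z < ε / 2 := by
    calc 2 / R * dist v z < 2 / R * (ε * R / 4) := by gcongr; exact hv'.2
      _ = ε / 2 := by
        field_simp
        ring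
  rw [dist_comm]
  linarith [dist_triangle (φ^[n] v) (φ^[n] z) w]

end IsHolomorphicSelfMap

theorem theorem3p1 (φ : ℂ → ℂ) (hφ : IsHolomorphicSelfMap φ) (α : ℝ) (hα : 0 < α) :
    ((IsRadialFixedPoint φ 1 ∧ ∃ d : ℝ, HasRadialDeriv φ 1 (d : ℂ) ∧ d ≤ 1) ↔
      IsSchur (fun z => atomicInner α (φ z) / atomicInner α z)) ∧
    (¬ EqOn φ id (Metric.ball 0 1) →
      ((IsRadialFixedPoint φ 1 ∧ ∃ d : ℝ, HasRadialDeriv φ 1 (d : ℂ) ∧ d ≤ 1) ↔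
        IsDenjoyWolffPoint φ 1)) := by
  have hiff : (IsRadialFixedPoint φ 1 ∧ ∃ d : ℝ, HasRadialDeriv φ 1 (d : ℂ) ∧ d ≤ 1) ↔
      PreservesHorodiscs φ :=
    ⟨fun ⟨hfix, _, hd, hd1⟩ => hφ.preservesHorodiscs_of_hasRadialDeriv hfix hd hd1,
      hφ.exists_hasRadialDeriv⟩
  refine ⟨hiff.trans (hφ.isSchur_iff_preservesHorodiscs hα).symm, fun hid => hiff.trans ?_⟩
  refine ⟨fun hJ => hφ.isDenjoyWolffPoint_of_tendsto (by simp)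
    fun z hz => hφ.tendsto_iterate hJ hid hz, fun h => ?_⟩
  have h0 : (0 : ℂ) ∈ Metric.ball (0 : ℂ) 1 := Metric.mem_ball_self one_pos
  exact hφ.preservesHorodiscs_of_tendsto_iterate h0
    ((h.2 {0} (singleton_subset_iff.2 h0) isCompact_singleton).tendsto_at (mem_singleton 0))
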